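/- Let $C_p$ be the space of continuous functions $f:\mathbb{R}\to\mathbb{R}$ with $f(x+1)=f(x)$ for all $x$, and let $C_p^r$ be the set of $u\in C_p$ whose derivatives $u^{(j)}$, $j=1,\dots,r$, exist and belong to $C_p$. For integers $N\ge 1$ and $k\ge 1$ put $h=1/N$, $x_i=ih$, and let $\mathcal V_h^k$ be the space of all $\phi\in C_p$ whose restriction to each $[x_{i-1},x_i]$, $i=1,\dots,N$, is a polynomial of degree at most $k$. Let $P=P_{h,k}:L^2(0,1)\to\mathcal V_h^k$ be the $L^2(0,1)$-orthogonal projection, $\|\cdot\|$ the norm of $L^2(0,1)$, $\|\cdot\|_\infty$ the $L^\infty$-norm, and let a subscript $x$ denote the derivative (of the piecewise differentiable function $Pu-u$, defined off the nodes). (i) For every odd integer $k\ge 1$ there is a constant $C_k>0$, depending only on $k$, such that for all $N\ge 1$ and all $u\in C_p^{k+2}$, with $P=P_{h,k}$, $$\|P[(Pu-u)_x]\|\le C_k\,h^{k+1}\,\|u^{(k+2)}\|_\infty .$$ (ii) There is an absolute constant $C>0$ such that for all $N\ge 1$ and all $u\in C_p^{5}$, with $k=1$ and $P=P_{h,1}$,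 $$\|P[(Pu-u)_x]\|\le C\,h^{4}\,\|u^{(5)}\|_\infty .$$ -/

import Mathlib

open MeasureTheory Set

namespace Dichotomy

/-- `C_p^r`: the real functions on `ℝ` of period `1` that are `r` times continuously differentiable
(the derivatives of order at most `r` are then continuous and of period `1` as well). -/
def Cp (r : ℕ) : Set (ℝ → ℝ) :=
  {u | ContDiff ℝ r u ∧ Function.Periodic u 1}

/-- The Lagrange finite element space `𝒱_h^k` with `h = 1 / N`: continuous functions of period `1`
whose restriction to each `[x_i, x_{i+1}]`, `x_i = i h`, `i = 0, …, N - 1`, is a polynomial of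
degree at most `k`. -/
def femSpace (N k : ℕ) : Submodule ℝ (ℝ → ℝ) where
  carrier := {φ | Continuous φ ∧ Function.Periodic φ 1 ∧
    ∀ i < N, ∃ p : Polynomial ℝ, p.natDegree ≤ k ∧
      ∀ x ∈ Icc ((i : ℝ) / N) (((i : ℝ) + 1) / N), φ x = p.eval x}
  add_mem' := by
    rintro a b ⟨ha, ha', ha''⟩ ⟨hb, hb', hb''⟩
    refine ⟨ha.add hb, ha'.add hb', fun i hi => ?_⟩
    obtain ⟨p, hp, hpx⟩ := ha'' i hi
    obtain ⟨q, hq, hqx⟩ := hb'' i hi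
    refine ⟨p + q, Polynomial.natDegree_add_le_of_degree_le hp hq, fun x hx => ?_⟩
    simp [hpx x hx, hqx x hx]
  zero_mem' := ⟨continuous_const, fun _ => rfl, fun _ _ => ⟨0, by simp, by simp⟩⟩
  smul_mem' := by
    rintro c a ⟨ha, ha', ha''⟩
    refine ⟨ha.const_smul c, fun x => by simp [ha' x], fun i hi => ?_⟩
    obtain ⟨p, hp, hpx⟩ := ha'' i hi
    refine ⟨c • p, (Polynomial.natDegree_smul_le c p).trans hp, fun x hx => ?_⟩
    simp [hpx x hx]

/-- Membership in `L²(0,1)`. -/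
def IsL2 (v : ℝ → ℝ) : Prop := MemLp v 2 (volume.restrict (Ioc (0 : ℝ) 1))

/-- `w` is the `L²(0,1)`-orthogonal projection of `v` onto `𝒱_h^k`, `h = 1 / N`. -/
def IsL2Proj (N k : ℕ) (v w : ℝ → ℝ) : Prop :=
  w ∈ femSpace N k ∧
    ∀ χ ∈ femSpace N k, ∫ x in (0 : ℝ)..1, w x * χ x = ∫ x in (0 : ℝ)..1, v x * χ x

theorem exists_cell {N : ℕ} (hN : 0 < N) {x : ℝ} (h0 : 0 ≤ x) (h1 : x < 1) :
    ∃ i < N, x ∈ Ico ((i : ℝ) / N) (((i : ℝ) + 1) / N) := by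
  have hN' : (0 : ℝ) < N := by exact_mod_cast hN
  refine ⟨⌊x * N⌋₊, ?_, ?_, ?_⟩
  · rw [Nat.floor_lt (by positivity)]
    nlinarith
  · rw [div_le_iff₀ hN']
    exact Nat.floor_le (by positivity)
  · rw [lt_div_iff₀ hN']
    exact Nat.lt_floor_add_one _

theorem eq_zero_of_Ico {φ : ℝ → ℝ} (hp : Function.Periodic φ 1)
    (h : ∀ x ∈ Ico (0 : ℝ) 1, φ x = 0) : φ = 0 := by
  funext x
  have hx : φ (x - (⌊x⌋ : ℤ) * 1) = φ x := hp.sub_int_mul_eq ⌊x⌋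
  rw [mul_one] at hx
  rw [← hx]
  exact h _ ⟨Int.fract_nonneg x, Int.fract_lt_one x⟩

theorem femSpace_finite {N : ℕ} (hN : 0 < N) (k : ℕ) :
    FiniteDimensional ℝ (femSpace N k) := by
  have hN' : (0 : ℝ) < N := by exact_mod_cast hN
  let L : femSpace N k →ₗ[ℝ] (Fin N × Fin (k + 1) → ℝ) :=
    { toFun := fun φ ij => φ.1 (((ij.1 : ℕ) + ((ij.2 : ℕ) : ℝ) / (k + 1)) / N)
      map_add' := fun _ _ => rfl
      map_smul' := fun _ _ => rfl }
  refine FiniteDimensional.of_injective L ?_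
  rw [← LinearMap.ker_eq_bot, LinearMap.ker_eq_bot']
  rintro ⟨φ, hφ⟩ h0
  apply Subtype.ext
  refine eq_zero_of_Ico hφ.2.1 fun x hx => ?_
  obtain ⟨i, hi, hxi⟩ := exists_cell hN hx.1 hx.2
  obtain ⟨p, hp, hpx⟩ := hφ.2.2 i hi
  suffices p = 0 by
    change φ x = 0
    rw [hpx x ⟨hxi.1, hxi.2.le⟩, this, Polynomial.eval_zero]
  have hk : (0 : ℝ) < (k : ℝ) + 1 := by positivity
  refine Polynomial.eq_zero_of_natDegree_lt_card_of_eval_eq_zero p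
    (f := fun j : Fin (k + 1) => ((i : ℝ) + ((j : ℕ) : ℝ) / (k + 1)) / N) ?_ ?_ ?_
  · intro a b hab
    have h2 : ((a : ℕ) : ℝ) = ((b : ℕ) : ℝ) := by
      simp only at hab
      field_simp at hab
      linarith
    exact Fin.ext (by exact_mod_cast h2)
  · intro j
    have h1 := congrFun h0 (⟨i, hi⟩, j)
    have hj : ((j : ℕ) : ℝ) ≤ (k : ℝ) + 1 := by exact_mod_cast j.2.le
    rw [← hpx]
    · exact h1
    · constructor
      · gcongr
        have : (0 : ℝ) ≤ ((j : ℕ) : ℝ) / (k + 1) := by positivity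
        linarith
      · gcongr
        rw [div_le_one hk]
        exact hj
  · simpa using Nat.lt_succ_of_le hp

theorem isL2_of_continuous {χ : ℝ → ℝ} (h : Continuous χ) : IsL2 χ := by
  obtain ⟨C, hC⟩ := (isCompact_Icc (a := (0 : ℝ)) (b := 1)).exists_bound_of_continuousOn
    h.continuousOn
  refine MemLp.of_bound h.aestronglyMeasurable C ?_
  filter_upwards [ae_restrict_mem measurableSet_Ioc] with x hx
  exact hC x ⟨hx.1.le, hx.2⟩

/-- Every `v ∈ L²(0,1)` has exactly one projection onto `𝒱_h^k`. -/
theorem existsUnique_isL2Proj {N : ℕ} (hN : 0 < N) (k : ℕ) {v : ℝ → ℝ} (hv : IsL2 v) :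
    ∃! w, IsL2Proj N k v w := by
  have int_mul : ∀ {f : ℝ → ℝ}, IsL2 f → ∀ χ : femSpace N k,
      IntervalIntegrable (fun x => f x * χ.1 x) volume 0 1 := fun {f} hf χ => by
    rw [intervalIntegrable_iff_integrableOn_Ioc_of_le zero_le_one]
    exact MemLp.integrable_mul hf (isL2_of_continuous χ.2.1)
  have sep : ∀ φ : femSpace N k, ∫ x in (0 : ℝ)..1, φ.1 x * φ.1 x = 0 → φ = 0 := by
    intro φ h
    apply Subtype.ext
    refine eq_zero_of_Ico φ.2.2.1 fun x hx => ?_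
    by_contra hne
    have hc : Continuous fun x => φ.1 x * φ.1 x := φ.2.1.mul φ.2.1
    have := intervalIntegral.integral_pos (a := 0) (b := 1) zero_lt_one hc.continuousOn
      (fun y _ => mul_self_nonneg _) ⟨x, ⟨hx.1, hx.2.le⟩, mul_self_pos.2 hne⟩
    exact this.ne' h
  let F : ∀ f : ℝ → ℝ, IsL2 f → (femSpace N k →ₗ[ℝ] ℝ) := fun f hf =>
    { toFun := fun χ => ∫ x in (0 : ℝ)..1, f x * χ.1 x
      map_add' := fun a b => by
        rw [← intervalIntegral.integral_add (int_mul hf a) (int_mul hf b)]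
        simp [mul_add]
      map_smul' := fun c a => by
        rw [RingHom.id_apply, smul_eq_mul, ← intervalIntegral.integral_const_mul]
        congr 1
        funext x
        simp [mul_left_comm] }
  let B : femSpace N k →ₗ[ℝ] (femSpace N k →ₗ[ℝ] ℝ) :=
    { toFun := fun φ => F φ.1 (isL2_of_continuous φ.2.1)
      map_add' := fun a b => by
        ext χ
        change (∫ x in (0 : ℝ)..1, (a + b).1 x * χ.1 x) =
          (∫ x in (0 : ℝ)..1, a.1 x * χ.1 x) + ∫ x in (0 : ℝ)..1, b.1 x * χ.1 x
        rw [← intervalIntegral.integral_add (int_mul (isL2_of_continuous a.2.1) χ)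
          (int_mul (isL2_of_continuous b.2.1) χ)]
        simp [add_mul]
      map_smul' := fun c a => by
        ext χ
        change (∫ x in (0 : ℝ)..1, (c • a).1 x * χ.1 x) = c * ∫ x in (0 : ℝ)..1, a.1 x * χ.1 x
        rw [← intervalIntegral.integral_const_mul]
        congr 1
        funext x
        simp [mul_assoc] }
  have hB : Function.Injective B := by
    rw [← LinearMap.ker_eq_bot, LinearMap.ker_eq_bot']
    intro φ h
    exact sep φ (LinearMap.congr_fun h φ)
  have := femSpace_finite hN k
  have hS : Function.Surjective B :=
    (LinearMap.injective_iff_surjective_of_finrank_eq_finrank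
      (Subspace.dual_finrank_eq (K := ℝ) (V := femSpace N k)).symm).1 hB
  obtain ⟨w, hw⟩ := hS (F v hv)
  refine ⟨w.1, ⟨w.2, fun χ hχ => LinearMap.congr_fun hw ⟨χ, hχ⟩⟩, ?_⟩
  rintro w' ⟨hw', h⟩
  have : B ⟨w', hw'⟩ = B w := by
    rw [hw]
    ext χ
    exact h χ.1 χ.2
  exact congrArg Subtype.val (hB this)

open Classical in
/-- The `L²`-projection `P : L²(0,1) → 𝒱_h^k`, `h = 1 / N`, `N > 0`
(with the value `0` at functions that are not in `L²(0,1)`). -/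
noncomputable def l2Proj (N k : ℕ) (v : ℝ → ℝ) : ℝ → ℝ :=
  if h : 0 < N ∧ IsL2 v then (existsUnique_isL2Proj h.1 k h.2).choose else 0

theorem l2Proj_spec {N : ℕ} (hN : 0 < N) (k : ℕ) {v : ℝ → ℝ} (hv : IsL2 v) :
    IsL2Proj N k v (l2Proj N k v) := by
  rw [l2Proj, dif_pos ⟨hN, hv⟩]
  exact (existsUnique_isL2Proj hN k hv).choose_spec.1

/-- `(P u - u)_x`. The function `P u - u` is differentiable off the nodes `x_i`; at a node the value
of `deriv` is irrelevant, since the nodes are a null set. -/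
noncomputable def errDeriv (N k : ℕ) (u : ℝ → ℝ) : ℝ → ℝ :=
  deriv fun x => l2Proj N k u x - u x

/-- `(P u - u)_x` lies in the domain `L²(0,1)` of the projection. -/
theorem isL2_errDeriv {N : ℕ} (hN : 0 < N) (k r : ℕ) {u : ℝ → ℝ} (hu : u ∈ Cp (r + 1)) :
    IsL2 (errDeriv N k u) := by
  have hN' : (0 : ℝ) < N := by exact_mod_cast hN
  have hu1 : ContDiff ℝ 1 u := hu.1.of_le (by exact_mod_cast Nat.le_add_left 1 r)
  have hw := (l2Proj_spec hN k (isL2_of_continuous hu.1.continuous)).1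
  set w := l2Proj N k u with hwdef
  choose! p hp hpx using hw.2.2
  have hcell : ∀ i : ℕ, ∃ C : ℝ, ∀ x ∈ Icc (0 : ℝ) 1,
      ‖(p i).derivative.eval x - deriv u x‖ ≤ C := fun i =>
    isCompact_Icc.exists_bound_of_continuousOn
      ((p i).derivative.continuous.sub (hu1.continuous_deriv le_rfl)).continuousOn
  choose C hC using hcell
  refine MemLp.of_bound (measurable_deriv _).aestronglyMeasurable (∑ i ∈ Finset.range N, |C i|) ?_
  have hnull : volume (⋃ i : ℕ, {(i : ℝ) / N}) = 0 :=
    (Set.countable_iUnion fun i => Set.countable_singleton _).measure_zero _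
  filter_upwards [ae_restrict_mem measurableSet_Ioc,
    ae_restrict_of_ae (measure_eq_zero_iff_ae_notMem.1 hnull)] with x hx hxn
  simp only [mem_iUnion, mem_singleton_iff, not_exists] at hxn
  have hx1 : x < 1 := lt_of_le_of_ne hx.2 fun h => hxn N (by rw [h, div_self hN'.ne'])
  obtain ⟨i, hi, hxi⟩ := exists_cell hN hx.1.le hx1
  have hlt : (i : ℝ) / N < x := lt_of_le_of_ne hxi.1 fun h => hxn i h.symm
  have hev : (fun y => w y - u y) =ᶠ[nhds x] fun y => (p i).eval y - u y := by
    filter_upwards [Ioo_mem_nhds hlt hxi.2] with y hy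
    rw [hpx i hi y ⟨hy.1.le, hy.2.le⟩]
  have hd : errDeriv N k u x = (p i).derivative.eval x - deriv u x := by
    change deriv (fun y => w y - u y) x = _
    rw [hev.deriv_eq]
    exact (((p i).hasDerivAt x).sub
      (hu1.differentiable one_ne_zero x).hasDerivAt).deriv
  rw [hd]
  refine (hC i x ⟨hx.1.le, hx.2⟩).trans ((le_abs_self _).trans ?_)
  exact Finset.single_le_sum (f := fun i => |C i|) (fun _ _ => abs_nonneg _)
    (Finset.mem_range.2 hi)

/-- The norm of `L²(0,1)`. -/
noncomputable def l2Norm (w : ℝ → ℝ) : ℝ := √(∫ x in (0 : ℝ)..1, w x ^ 2)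

/-- The sup norm (the `L^∞` norm, for the continuous periodic functions it is applied to). -/
noncomputable def supNorm (f : ℝ → ℝ) : ℝ := ⨆ x : ℝ, |f x|

end Dichotomy

namespace Dichotomy

/-! Write g = P[(Pu - u)_x]. Testing with g and integrating by parts gives ‖g‖² = -∫ (Pu - u) g_x.
The inverse inequality ‖g_x‖ ≤ K h⁻¹ ‖g‖ costs one power of h, so for (i) the error must act on
piecewise polynomials as if it had size h^(k+2), one order better than approximation theory gives.

For odd k it does. On each cell the degree k+1 term of the Taylor polynomial of u is replaced by a
multiple of the Legendre polynomial L of degree k+1, which is invisible to polynomials of degree at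
most k. Since k+1 is even, L takes equal values at both cell ends, so the jumps caused by
subtracting these multiples are only O(h^(k+2)), like the Taylor jumps, and a linear correction
removes them. The resulting w in the space (`exists_quasi_interpolant`) has w - u paired with any
discontinuous piecewise polynomial ψ of degree at most k bounded by C h^(k+2) ‖u^(k+2)‖_∞ ‖ψ‖.
Taking ψ = Pu - w bounds Pu - w, and ψ = g_x then finishes (i).

For (ii), g is tested with its Simpson mean Mg = (g(x-h) + 4g(x) + g(x+h))/6 instead. In nodal
values of piecewise linear functions the mass matrix is hM and the derivative matrix is hD, with D
the centred difference quotient, so ∫ w_x Mχ = ∫ (Dw) χ (`integral_deriv_mul_simpson`). As D is skew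
and preserves the space, Pu may be replaced by u, and ∫ g Mg = ∫ (Du - Mu') g. The bracket is the
error of Simpson's rule for u', of order h⁴, and M is coercive. -/

/-! ### Polynomial and Taylor estimates on an interval -/

-- Repeated integration by parts: each step moves one derivative onto `p`. Boundary terms vanish
-- because fewer than `n` derivatives of (X(1 - X))^n leave a factor X(1 - X); at `j = 0` the degree
-- bound forces `p = 0`.
open Polynomial in
theorem integral_iterate_derivative_mul_eq_zero (n : ℕ) (p : ℝ[X]) (j : ℕ) (hj : j ≤ n)
    (hp : p.degree < j) :
    ∫ t in (0 : ℝ)..1, (derivative^[j] ((X : ℝ[X]) ^ n * (1 - X) ^ n)).eval t * p.eval t = 0 := by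
  induction j generalizing p with
  | zero =>
    have : p = 0 := by
      rw [← degree_eq_bot]
      simpa using hp
    simp [this]
  | succ j ih =>
    set W : ℝ[X] := derivative^[j] ((X : ℝ[X]) ^ n * (1 - X) ^ n) with hW
    have hdvd : ((X : ℝ[X]) * (1 - X)) ^ (n - j) ∣ W := by
      rw [hW, ← mul_pow]
      exact pow_sub_dvd_iterate_derivative_pow _ _ _
    have hroot : ∀ x : ℝ, x * (1 - x) = 0 → W.eval x = 0 := by
      intro x hx
      obtain ⟨r, hr⟩ := hdvd
      have : n - j ≠ 0 := by omega
      simp [hr, hx, this]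
    have h0 := hroot 0 (by simp)
    have h1 := hroot 1 (by simp)
    have hp' : p.derivative.degree < j := by
      by_cases h : p = 0
      · simp [h]
      · refine lt_of_lt_of_le (degree_derivative_lt h) ?_
        rw [degree_eq_natDegree h] at hp ⊢
        exact_mod_cast Nat.le_of_lt_succ (by exact_mod_cast hp)
    have hder : derivative^[j + 1] ((X : ℝ[X]) ^ n * (1 - X) ^ n) = derivative W := by
      rw [Function.iterate_succ_apply']
    rw [hder]
    have hparts := intervalIntegral.integral_mul_deriv_eq_deriv_mul_of_hasDerivAt (a := 0) (b := 1)
      (u := fun t => W.eval t) (v := fun t => p.eval t)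
      (u' := fun t => (derivative W).eval t) (v' := fun t => (derivative p).eval t)
      W.continuous.continuousOn p.continuous.continuousOn
      (fun x _ => W.hasDerivAt x) (fun x _ => p.hasDerivAt x)
      ((derivative W).continuous.intervalIntegrable _ _)
      ((derivative p).continuous.intervalIntegrable _ _)
    rw [ih _ (by omega) hp', h0, h1] at hparts
    linarith

open Polynomial in
/-- For even `n`, a multiple of the shifted Legendre polynomial of degree `n` is monic, takes equal
values at `0` and `1`, and is orthogonal to all polynomials of lower degree. -/
theorem exists_legendre {n : ℕ} (hn : Even n) : ∃ L : ℝ[X], L.natDegree ≤ n ∧ L.coeff n = 1 ∧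
    L.eval 0 = L.eval 1 ∧
      ∀ p : ℝ[X], p.degree < n → ∫ t in (0 : ℝ)..1, L.eval t * p.eval t = 0 := by
  set S : ℝ[X] := (shiftedLegendre n).map (Int.castRingHom ℝ) with hS
  have hc : S.coeff n ≠ 0 := by
    simp [hS, coeff_shiftedLegendre, (Nat.choose_pos (show n ≤ n + n by simp)).ne']
  have hrod : derivative^[n] ((X : ℝ[X]) ^ n * (1 - X) ^ n) = C (n.factorial : ℝ) * S := by
    have := congrArg (Polynomial.map (Int.castRingHom ℝ)) (factorial_mul_shiftedLegendre_eq n)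
    simp only [Polynomial.map_mul, Polynomial.map_natCast] at this
    rw [← iterate_derivative_map] at this
    simpa using this.symm
  refine ⟨C (S.coeff n)⁻¹ * S, ?_, ?_, ?_, fun p hp => ?_⟩
  · refine natDegree_C_mul_le _ _ |>.trans (natDegree_map_le.trans ?_)
    simp
  · simp [hc]
  -- The symmetry about 1/2 carries the sign (-1)^n, which is where evenness of `n` enters.
  · have := shiftedLegendre_eval_symm n (0 : ℝ)
    simp only [hn.neg_one_pow, one_mul, sub_zero, aeval_def] at this
    simp only [eval_mul, eval_C, hS, eval_map]
    congr 1
  · have := integral_iterate_derivative_mul_eq_zero n p n le_rfl hp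
    rw [hrod] at this
    simp only [eval_mul, eval_C, mul_assoc, intervalIntegral.integral_const_mul] at this ⊢
    simp only [mul_eq_zero, Nat.cast_eq_zero, Nat.factorial_ne_zero, false_or] at this
    simp [this]

theorem eq_zero_of_integral_sq_eq_zero {p : Polynomial ℝ}
    (h : ∫ t in (0 : ℝ)..1, p.eval t ^ 2 = 0) : p = 0 := by
  refine Polynomial.eq_zero_of_infinite_isRoot p
    ((Icc_infinite (zero_lt_one (α := ℝ))).mono fun x hx => ?_)
  by_contra hne
  have := intervalIntegral.integral_pos (a := 0) (b := 1) zero_lt_one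
    (f := fun t => p.eval t ^ 2) (by fun_prop) (fun y _ => sq_nonneg _)
    ⟨x, hx, sq_pos_of_ne_zero hne⟩
  exact this.ne' h

/-- The inverse inequality on the unit interval. -/
theorem exists_integral_derivative_sq_le (k : ℕ) : ∃ K : ℝ, 0 < K ∧ ∀ p : Polynomial ℝ,
    p.natDegree ≤ k →
      ∫ t in (0 : ℝ)..1, p.derivative.eval t ^ 2 ≤ K ^ 2 * ∫ t in (0 : ℝ)..1, p.eval t ^ 2 := by
  set μ : Measure ℝ := volume.restrict (Ioc (0 : ℝ) 1) with hμ
  have hmem : ∀ p : Polynomial ℝ, MemLp (fun x => p.eval x) 2 μ := fun p =>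
    isL2_of_continuous p.continuous
  let T : Polynomial ℝ →ₗ[ℝ] Lp ℝ 2 μ :=
    { toFun := fun p => (hmem p).toLp _
      map_add' := fun p q => by
        rw [← MemLp.toLp_add]
        congr 1
        funext x
        simp
      map_smul' := fun c p => by
        rw [RingHom.id_apply, ← MemLp.toLp_const_smul]
        congr 1
        funext x
        simp }
  have hT : ∀ p : Polynomial ℝ, ‖T p‖ ^ 2 = ∫ t in (0 : ℝ)..1, p.eval t ^ 2 := by
    intro p
    rw [← real_inner_self_eq_norm_sq, L2.inner_def, intervalIntegral.integral_of_le zero_le_one]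
    refine integral_congr_ae ?_
    filter_upwards [(hmem p).coeFn_toLp] with x hx
    change inner ℝ ((hmem p).toLp _ x) ((hmem p).toLp _ x) = _
    rw [hx]
    simp [sq]
  let e := Polynomial.degreeLTEquiv ℝ (k + 1)
  let J : (Fin (k + 1) → ℝ) →ₗ[ℝ] Polynomial ℝ :=
    (Polynomial.degreeLT ℝ (k + 1)).subtype ∘ₗ e.symm.toLinearMap
  have hker : LinearMap.ker (T ∘ₗ J) = ⊥ := by
    rw [LinearMap.ker_eq_bot']
    intro c hc
    have h1 : J c = 0 := by
      apply eq_zero_of_integral_sq_eq_zero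
      rw [← hT]
      simpa using hc
    have h2 : e.symm c = 0 := Subtype.ext h1
    simpa using h2
  -- Finite dimension: the injective map from coefficients to L² is bounded below, and
  -- differentiation is bounded in terms of the coefficients. Their constants multiply; the added 1
  -- only secures positivity.
  obtain ⟨K, hK, hanti⟩ := (T ∘ₗ J).exists_antilipschitzWith hker
  let D := (T ∘ₗ Polynomial.derivative ∘ₗ J).toContinuousLinearMap
  refine ⟨(‖D‖ + 1) * K, by positivity, fun p hp => ?_⟩
  have hpmem : p ∈ Polynomial.degreeLT ℝ (k + 1) := by
    rw [Polynomial.mem_degreeLT]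
    exact lt_of_le_of_lt Polynomial.degree_le_natDegree (by exact_mod_cast Nat.lt_succ_of_le hp)
  set c := e ⟨p, hpmem⟩ with hc
  have hJ : J c = p := by simp [J, hc]
  have h1 : ‖T p.derivative‖ ≤ ‖D‖ * ‖c‖ := by
    have := D.le_opNorm c
    simpa [D, hJ] using this
  have h2 : ‖c‖ ≤ K * ‖T p‖ := by
    have := hanti.le_mul_dist c 0
    simpa [hJ] using this
  rw [← hT, ← hT, ← mul_pow]
  refine pow_le_pow_left₀ (norm_nonneg _) ?_ 2
  calc ‖T p.derivative‖ ≤ ‖D‖ * (K * ‖T p‖) := h1.trans (by gcongr)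
    _ ≤ (‖D‖ + 1) * K * ‖T p‖ := by
      rw [← mul_assoc]
      gcongr
      linarith

/-- Taylor's theorem for a globally smooth function, with a bound on the remainder. -/
theorem abs_sub_taylor_le {f : ℝ → ℝ} {n : ℕ} (hf : ContDiff ℝ (n + 1 : ℕ) f) {B : ℝ}
    (hB : ∀ x, |iteratedDeriv (n + 1) f x| ≤ B) (a : ℝ) {t : ℝ} (ht : 0 ≤ t) :
    |f (a + t) - ∑ j ∈ Finset.range (n + 1), iteratedDeriv j f a / j.factorial * t ^ j| ≤
      B * t ^ (n + 1) := by
  have hB0 : 0 ≤ B := (abs_nonneg _).trans (hB 0)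
  rcases ht.eq_or_lt with rfl | ht'
  · simp [Finset.sum_range_succ']
  have hlt : a < a + t := by linarith
  have hx : a + t ∈ Icc a (a + t) := ⟨hlt.le, le_rfl⟩
  have hw : ∀ j ≤ n + 1, ∀ y ∈ Icc a (a + t),
      iteratedDerivWithin j f (Icc a (a + t)) y = iteratedDeriv j f y := fun j hj y hy =>
    iteratedDerivWithin_eq_iteratedDeriv (uniqueDiffOn_Icc hlt)
      (hf.contDiffAt.of_le (by exact_mod_cast hj)) hy
  have := taylor_mean_remainder_bound (n := n) (C := B) hlt.le
    (by exact_mod_cast hf.contDiffOn) hx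
    (fun y hy => by rw [hw _ le_rfl y hy]; exact hB y)
  rw [taylor_within_apply, Real.norm_eq_abs, add_sub_cancel_left] at this
  have hsum : ∑ j ∈ Finset.range (n + 1), ((j.factorial : ℝ)⁻¹ * t ^ j) •
      iteratedDerivWithin j f (Icc a (a + t)) a =
      ∑ j ∈ Finset.range (n + 1), iteratedDeriv j f a / j.factorial * t ^ j := by
    refine Finset.sum_congr rfl fun j hj => ?_
    rw [hw j (by have := Finset.mem_range.1 hj; omega) a ⟨le_rfl, hlt.le⟩, smul_eq_mul]
    ring
  rw [hsum] at this
  refine this.trans (div_le_self (by positivity) ?_)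
  exact_mod_cast Nat.factorial_pos n

/-! ### Pairings, norms and cell sums in L²(0,1) -/

theorem IsL2.intervalIntegrable_mul {f g : ℝ → ℝ} (hf : IsL2 f) (hg : IsL2 g) :
    IntervalIntegrable (fun x => f x * g x) volume 0 1 := by
  rw [intervalIntegrable_iff_integrableOn_Ioc_of_le zero_le_one]
  exact MemLp.integrable_mul hf hg

theorem integral_add_mul {f g h : ℝ → ℝ} (hf : IsL2 f) (hg : IsL2 g) (hh : IsL2 h) :
    ∫ x in (0 : ℝ)..1, (f x + g x) * h x =
      (∫ x in (0 : ℝ)..1, f x * h x) + ∫ x in (0 : ℝ)..1, g x * h x := by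
  simp only [add_mul]
  exact intervalIntegral.integral_add (hf.intervalIntegrable_mul hh) (hg.intervalIntegrable_mul hh)

theorem integral_sub_mul {f g h : ℝ → ℝ} (hf : IsL2 f) (hg : IsL2 g) (hh : IsL2 h) :
    ∫ x in (0 : ℝ)..1, (f x - g x) * h x =
      (∫ x in (0 : ℝ)..1, f x * h x) - ∫ x in (0 : ℝ)..1, g x * h x := by
  simp only [sub_mul]
  exact intervalIntegral.integral_sub (hf.intervalIntegrable_mul hh) (hg.intervalIntegrable_mul hh)

theorem l2Norm_nonneg (f : ℝ → ℝ) : 0 ≤ l2Norm f := Real.sqrt_nonneg _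

theorem l2Norm_sq (f : ℝ → ℝ) : l2Norm f ^ 2 = ∫ x in (0 : ℝ)..1, f x ^ 2 :=
  Real.sq_sqrt (intervalIntegral.integral_nonneg zero_le_one fun _ _ => sq_nonneg _)

theorem IsL2.norm_toLp {f : ℝ → ℝ} (hf : IsL2 f) : ‖MemLp.toLp f hf‖ = l2Norm f := by
  rw [← abs_of_nonneg (norm_nonneg (MemLp.toLp f hf)), ← abs_of_nonneg (l2Norm_nonneg f),
    ← sq_eq_sq_iff_abs_eq_abs, l2Norm_sq, ← real_inner_self_eq_norm_sq, L2.inner_def,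
    intervalIntegral.integral_of_le zero_le_one]
  refine integral_congr_ae ?_
  filter_upwards [MemLp.coeFn_toLp hf] with x hx
  rw [hx]
  simp [sq]

theorem abs_integral_mul_le {f g : ℝ → ℝ} (hf : IsL2 f) (hg : IsL2 g) :
    |∫ x in (0 : ℝ)..1, f x * g x| ≤ l2Norm f * l2Norm g := by
  have h := abs_real_inner_le_norm (MemLp.toLp f hf) (MemLp.toLp g hg)
  rw [hf.norm_toLp, hg.norm_toLp, L2.inner_def] at h
  rw [intervalIntegral.integral_of_le zero_le_one]
  convert h using 2
  refine integral_congr_ae ?_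
  filter_upwards [MemLp.coeFn_toLp hf, MemLp.coeFn_toLp hg] with x hx hy
  rw [hx, hy]
  simp [mul_comm]

theorem IsL2.abs {f : ℝ → ℝ} (hf : IsL2 f) : IsL2 fun x => |f x| := MemLp.abs hf

theorem IsL2.intervalIntegrable {f : ℝ → ℝ} (hf : IsL2 f) : IntervalIntegrable f volume 0 1 := by
  simpa using hf.intervalIntegrable_mul (isL2_of_continuous (continuous_const (y := (1 : ℝ))))

theorem integral_abs_le_l2Norm {f : ℝ → ℝ} (hf : IsL2 f) :
    ∫ x in (0 : ℝ)..1, |f x| ≤ l2Norm f := by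
  have h := abs_integral_mul_le hf.abs (isL2_of_continuous (continuous_const (y := (1 : ℝ))))
  simp only [mul_one] at h
  refine (le_abs_self _).trans (h.trans_eq ?_)
  simp [l2Norm]

theorem l2Norm_le_of_sq_le {f : ℝ → ℝ} {c : ℝ} (hc : 0 ≤ c)
    (h : ∫ x in (0 : ℝ)..1, f x * f x ≤ c * l2Norm f) : l2Norm f ≤ c := by
  have h2 : l2Norm f * l2Norm f ≤ c * l2Norm f := by
    rw [← sq, l2Norm_sq]
    simpa only [sq] using h
  rcases (l2Norm_nonneg f).eq_or_lt with h0 | h0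
  · rwa [← h0]
  · exact le_of_mul_le_mul_right h2 h0

/-- The integral over the unit interval as a sum over the `N` cells. -/
theorem integral_eq_sum_cells {N : ℕ} (hN : 0 < N) {f : ℝ → ℝ}
    (hf : IntervalIntegrable f volume 0 1) :
    ∫ x in (0 : ℝ)..1, f x =
      (N : ℝ)⁻¹ * ∑ i ∈ Finset.range N, ∫ t in (0 : ℝ)..1, f ((((i : ℤ) : ℝ) + t) / N) := by
  have hN' : (0 : ℝ) < N := by exact_mod_cast hN
  have hadj := intervalIntegral.sum_integral_adjacent_intervals (f := f) (μ := volume)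
    (a := fun i : ℕ => (i : ℝ) / N) (n := N) (fun i hi => hf.mono_set ?_)
  · simp only [Nat.cast_zero, zero_div, div_self hN'.ne'] at hadj
    rw [← hadj, Finset.mul_sum]
    refine Finset.sum_congr rfl fun i _ => ?_
    have := intervalIntegral.integral_comp_add_div (a := 0) (b := 1) f hN'.ne' ((i : ℝ) / N)
    simp only [zero_div, add_zero, smul_eq_mul, ← add_div] at this
    push_cast
    rw [this]
    field_simp
  · have hi' : (i : ℝ) + 1 ≤ N := by exact_mod_cast hi
    rw [uIcc_of_le zero_le_one, uIcc_of_le (by gcongr; simp)]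
    refine Icc_subset_Icc (by positivity) ?_
    rw [div_le_one hN']
    exact_mod_cast hi

/-! ### The finite element space in cell coordinates -/

section femSpace

variable {N k : ℕ} {φ : ℝ → ℝ}

/-- Indexing cells by all integers, with local coordinate in [0,1], makes translation by nodes and
wrap-around uniform. Periodicity reduces the index modulo `N`. -/
theorem mem_femSpace_iff (hN : 0 < N) : φ ∈ femSpace N k ↔
    Continuous φ ∧ Function.Periodic φ 1 ∧ ∀ i : ℤ, ∃ q : Polynomial ℝ, q.natDegree ≤ k ∧
      ∀ t ∈ Icc (0 : ℝ) 1, φ (((i : ℝ) + t) / N) = q.eval t := by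
  have hN' : (0 : ℝ) < N := by exact_mod_cast hN
  refine ⟨fun ⟨h1, h2, h3⟩ => ⟨h1, h2, fun i => ?_⟩, fun ⟨h1, h2, h3⟩ => ⟨h1, h2, fun i hi => ?_⟩⟩
  · have hm := Int.emod_nonneg i (show (N : ℤ) ≠ 0 by omega)
    have hlt := Int.emod_lt_of_pos i (show (0 : ℤ) < N by omega)
    obtain ⟨p, hp, hpx⟩ := h3 (i % N).toNat (by omega)
    have hcast : (((i % N).toNat : ℕ) : ℝ) = ((i % N : ℤ) : ℝ) := by
      exact_mod_cast Int.toNat_of_nonneg hm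
    rw [hcast] at hpx
    have hi : (i : ℝ) = ((i % N : ℤ) : ℝ) + N * ((i / N : ℤ) : ℝ) := by
      exact_mod_cast (Int.emod_add_mul_ediv i N).symm
    refine ⟨p.comp (Polynomial.C (N : ℝ)⁻¹ * (Polynomial.X + Polynomial.C ((i % N : ℤ) : ℝ))),
      ?_, fun t ht => ?_⟩
    · refine Polynomial.natDegree_comp_le.trans ?_
      calc _ ≤ p.natDegree * 1 := by
            gcongr
            refine (Polynomial.natDegree_C_mul_le _ _).trans ?_
            exact (Polynomial.natDegree_X_add_C _).le
        _ ≤ k := by simpa using hp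
    · have h4 : ((i : ℝ) + t) / N = (((i % N : ℤ) : ℝ) + t) / N + ((i / N : ℤ) : ℝ) * 1 := by
        rw [hi]
        field_simp
        ring
      rw [h4, h2.int_mul (i / N), hpx]
      · simp only [Polynomial.eval_comp, Polynomial.eval_mul, Polynomial.eval_C,
          Polynomial.eval_add, Polynomial.eval_X]
        congr 1
        ring
      · constructor <;> gcongr <;> linarith [ht.1, ht.2]
  · obtain ⟨q, hq, hqt⟩ := h3 i
    refine ⟨q.comp (Polynomial.C (N : ℝ) * Polynomial.X + Polynomial.C (-(i : ℝ))),
      ?_, fun x hx => ?_⟩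
    · refine Polynomial.natDegree_comp_le.trans ?_
      calc _ ≤ q.natDegree * 1 := by
            gcongr
            exact Polynomial.natDegree_linear_le
        _ ≤ k := by simpa using hq
    · have := hqt (N * x - i) ⟨?_, ?_⟩
      · rw [show (((i : ℤ) : ℝ) + (N * x - i)) / N = x by
          push_cast
          field_simp
          ring] at this
        rw [this]
        simp [sub_eq_add_neg]
      · have := (div_le_iff₀ hN').1 hx.1
        linarith
      · have := (le_div_iff₀ hN').1 hx.2
        linarith

theorem comp_add_mem_femSpace (hN : 0 < N) (hφ : φ ∈ femSpace N k) (m : ℤ) :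
    (fun x => φ (x + m / N)) ∈ femSpace N k := by
  rw [mem_femSpace_iff hN] at hφ ⊢
  obtain ⟨h1, h2, h3⟩ := hφ
  refine ⟨by fun_prop, h2.add_const _, fun i => ?_⟩
  obtain ⟨q, hq, hqt⟩ := h3 (i + m)
  refine ⟨q, hq, fun t ht => ?_⟩
  rw [← hqt t ht]
  congr 1
  push_cast
  ring

theorem hasDerivAt_of_cell (hN : 0 < N) {i : ℤ} {q : Polynomial ℝ}
    (h : ∀ t ∈ Icc (0 : ℝ) 1, φ (((i : ℝ) + t) / N) = q.eval t) {t : ℝ} (ht : t ∈ Ioo (0 : ℝ) 1) :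
    HasDerivAt φ (N * q.derivative.eval t) (((i : ℝ) + t) / N) := by
  have hN' : (0 : ℝ) < N := by exact_mod_cast hN
  have ht' : N * (((i : ℝ) + t) / N) - i = t := by
    field_simp
    ring
  have h1 : HasDerivAt (fun x : ℝ => N * x - (i : ℝ)) N (((i : ℝ) + t) / N) := by
    simpa using ((hasDerivAt_id (((i : ℝ) + t) / N)).const_mul (N : ℝ)).sub_const (i : ℝ)
  have h2 : HasDerivAt (fun x : ℝ => q.eval (N * x - i)) (N * q.derivative.eval t)
      (((i : ℝ) + t) / N) := by
    have h3 := q.hasDerivAt (N * (((i : ℝ) + t) / N) - i)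
    rw [ht'] at h3
    rw [mul_comm]
    refine HasDerivAt.comp (((i : ℝ) + t) / N) (h₂ := fun y : ℝ => q.eval y)
      (h := fun x : ℝ => N * x - (i : ℝ)) ?_ h1
    rw [ht']
    exact h3
  refine h2.congr_of_eventuallyEq ?_
  have hc : Continuous fun x : ℝ => N * x - (i : ℝ) := by fun_prop
  have : ∀ᶠ x in nhds (((i : ℝ) + t) / N), N * x - (i : ℝ) ∈ Ioo (0 : ℝ) 1 :=
    hc.continuousAt.eventually_mem (by rw [ht']; exact Ioo_mem_nhds ht.1 ht.2)
  filter_upwards [this] with x hx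
  rw [← h _ ⟨hx.1.le, hx.2.le⟩]
  congr 1
  field_simp
  ring

/-- The nodes `i / N`, `i ∈ ℤ`. -/
def nodes (N : ℕ) : Set ℝ := range fun i : ℤ => (i : ℝ) / N

theorem countable_nodes (N : ℕ) : (nodes N).Countable := countable_range _

theorem exists_cell_of_notMem_nodes (hN : 0 < N) {x : ℝ} (hx : x ∉ nodes N) :
    ∃ i : ℤ, ∃ t ∈ Ioo (0 : ℝ) 1, x = ((i : ℝ) + t) / N := by
  have hN' : (0 : ℝ) < N := by exact_mod_cast hN
  have hfl := Int.floor_add_fract (N * x)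
  refine ⟨⌊N * x⌋, Int.fract (N * x), ⟨?_, Int.fract_lt_one _⟩, ?_⟩
  · refine lt_of_le_of_ne (Int.fract_nonneg _) fun h => hx ⟨⌊N * x⌋, ?_⟩
    rw [← h, add_zero] at hfl
    change ((⌊N * x⌋ : ℤ) : ℝ) / N = x
    rw [hfl]
    field_simp
  · rw [hfl]
    field_simp

theorem differentiableAt_of_mem_femSpace (hN : 0 < N) (hφ : φ ∈ femSpace N k) {x : ℝ}
    (hx : x ∉ nodes N) : DifferentiableAt ℝ φ x := by
  obtain ⟨i, t, ht, rfl⟩ := exists_cell_of_notMem_nodes hN hx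
  obtain ⟨q, -, hq⟩ := ((mem_femSpace_iff hN).1 hφ).2.2 i
  exact (hasDerivAt_of_cell hN hq ht).differentiableAt

theorem ae_notMem_nodes (N : ℕ) : ∀ᵐ x : ℝ, x ∉ nodes N :=
  measure_eq_zero_iff_ae_notMem.1 ((countable_nodes N).measure_zero _)

theorem isL2_deriv (hN : 0 < N) (hφ : φ ∈ femSpace N k) : IsL2 (deriv φ) := by
  have hN' : (0 : ℝ) < N := by exact_mod_cast hN
  choose q hq hqt using ((mem_femSpace_iff hN).1 hφ).2.2
  have hb : ∀ i : ℤ, ∃ C : ℝ, ∀ t ∈ Icc (0 : ℝ) 1, ‖N * (q i).derivative.eval t‖ ≤ C := fun i =>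
    isCompact_Icc.exists_bound_of_continuousOn
      (continuous_const.mul (q i).derivative.continuous).continuousOn
  choose C hC using hb
  refine MemLp.of_bound (measurable_deriv _).aestronglyMeasurable
    (∑ i ∈ Finset.Ico (0 : ℤ) N, |C i|) ?_
  filter_upwards [ae_restrict_mem measurableSet_Ioc, ae_restrict_of_ae (ae_notMem_nodes N)]
    with x hx hxn
  obtain ⟨i, t, ht, rfl⟩ := exists_cell_of_notMem_nodes hN hxn
  rw [(hasDerivAt_of_cell hN (hqt i) ht).deriv]
  refine (hC i t ⟨ht.1.le, ht.2.le⟩).trans ((le_abs_self _).trans ?_)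
  refine Finset.single_le_sum (f := fun i => |C i|) (fun _ _ => abs_nonneg _) ?_
  have h1 : 0 < (i : ℝ) + t := by
    have := hx.1
    rwa [lt_div_iff₀ hN', zero_mul] at this
  have h2 : (i : ℝ) + t ≤ N := (div_le_one hN').1 hx.2
  rw [Finset.mem_Ico]
  constructor
  · have : (-1 : ℝ) < i := by linarith [ht.2]
    have : (-1 : ℤ) < i := by exact_mod_cast this
    omega
  · have : (i : ℝ) < N := by linarith [ht.1]
    exact_mod_cast this

/-- Integration by parts for periodic functions that are differentiable off the nodes. -/
theorem integral_deriv_mul_eq_neg {s : Set ℝ} (hs : s.Countable) {f g : ℝ → ℝ}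
    (hf : Continuous f) (hg : Continuous g) (hfp : Function.Periodic f 1)
    (hgp : Function.Periodic g 1) (hfd : ∀ x ∉ s, DifferentiableAt ℝ f x)
    (hgd : ∀ x ∉ s, DifferentiableAt ℝ g x) (hf2 : IsL2 (deriv f)) (hg2 : IsL2 (deriv g)) :
    ∫ x in (0 : ℝ)..1, deriv f x * g x = -∫ x in (0 : ℝ)..1, f x * deriv g x := by
  have hi1 := hf2.intervalIntegrable_mul (isL2_of_continuous hg)
  have hi2 := (isL2_of_continuous hf).intervalIntegrable_mul hg2
  have h := integral_eq_of_hasDerivAt_off_countable_of_le (fun x => f x * g x)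
    (fun x => deriv f x * g x + f x * deriv g x) zero_le_one hs (hf.mul hg).continuousOn
    (fun x hx => (hfd x hx.2).hasDerivAt.mul (hgd x hx.2).hasDerivAt) (hi1.add hi2)
  rw [intervalIntegral.integral_add hi1 hi2] at h
  have h0 : f 1 = f 0 := by simpa using hfp 0
  have h1 : g 1 = g 0 := by simpa using hgp 0
  rw [h0, h1] at h
  linarith

theorem integral_cell_congr {f g : ℝ → ℝ} (h : ∀ t ∈ Ioo (0 : ℝ) 1, f t = g t) :
    ∫ t in (0 : ℝ)..1, f t = ∫ t in (0 : ℝ)..1, g t := by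
  rw [intervalIntegral.integral_of_le zero_le_one, intervalIntegral.integral_of_le zero_le_one,
    integral_Ioc_eq_integral_Ioo, integral_Ioc_eq_integral_Ioo]
  exact setIntegral_congr_fun measurableSet_Ioo h

/-- The unit-interval inequality is scaled to each cell, where the chain rule produces the factor
`N`, and summed. -/
theorem exists_l2Norm_deriv_le (k : ℕ) : ∃ K : ℝ, 0 < K ∧ ∀ N : ℕ, 0 < N → ∀ φ ∈ femSpace N k,
    l2Norm (deriv φ) ≤ K * N * l2Norm φ := by
  obtain ⟨K, hK, h⟩ := exists_integral_derivative_sq_le k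
  refine ⟨K, hK, fun N hN φ hφ => ?_⟩
  refine le_of_sq_le_sq ?_ (mul_nonneg (by positivity) (l2Norm_nonneg _))
  choose q hq hqt using ((mem_femSpace_iff hN).1 hφ).2.2
  have hd := isL2_deriv hN hφ
  have hφ2 := isL2_of_continuous hφ.1
  rw [mul_pow, l2Norm_sq, l2Norm_sq,
    integral_eq_sum_cells hN (by simpa only [sq] using hd.intervalIntegrable_mul hd),
    integral_eq_sum_cells hN (by simpa only [sq] using hφ2.intervalIntegrable_mul hφ2),
    mul_left_comm]
  gcongr
  rw [Finset.mul_sum]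
  refine Finset.sum_le_sum fun i _ => ?_
  rw [integral_cell_congr (g := fun t => (N : ℝ) ^ 2 * (q i).derivative.eval t ^ 2)
      (fun t ht => by rw [(hasDerivAt_of_cell hN (hqt i) ht).deriv, mul_pow]),
    integral_cell_congr (f := fun t => φ ((((i : ℤ) : ℝ) + t) / N) ^ 2)
      (g := fun t => (q i).eval t ^ 2) (fun t ht => by rw [hqt i t ⟨ht.1.le, ht.2.le⟩]),
    intervalIntegral.integral_const_mul, mul_pow, mul_comm (K ^ 2), mul_assoc]
  gcongr
  exact h _ (hq i)

theorem locallyFinite_Icc_int : LocallyFinite fun i : ℤ => Icc (i : ℝ) (i + 1) := by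
  intro x
  refine ⟨Ioo (x - 1) (x + 1), Ioo_mem_nhds (by linarith) (by linarith), ?_⟩
  refine (finite_Icc (⌊x⌋ - 3) (⌊x⌋ + 3)).subset ?_
  rintro i ⟨y, ⟨h1, h2⟩, h3, h4⟩
  have h5 := Int.floor_le x
  have h6 := Int.lt_floor_add_one x
  constructor
  · have : ((⌊x⌋ - 3 : ℤ) : ℝ) ≤ i := by
      push_cast
      linarith
    exact_mod_cast this
  · have : (i : ℝ) ≤ ((⌊x⌋ + 3 : ℤ) : ℝ) := by
      push_cast
      linarith
    exact_mod_cast this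

/-- Matching polynomial pieces on the cells define an element of the finite element space. -/
theorem exists_mem_femSpace_of_pieces (hN : 0 < N) {Q : ℤ → Polynomial ℝ}
    (hdeg : ∀ i, (Q i).natDegree ≤ k) (hmatch : ∀ i, (Q i).eval 1 = (Q (i + 1)).eval 0)
    (hper : ∀ i, Q (i + N) = Q i) :
    ∃ w ∈ femSpace N k, ∀ i : ℤ, ∀ t ∈ Icc (0 : ℝ) 1, w (((i : ℝ) + t) / N) = (Q i).eval t := by
  have hN' : (0 : ℝ) < N := by exact_mod_cast hN
  -- In the variable y = Nx the cells are [i, i+1]. At an integer the floor selects the right-hand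
  -- piece; `hmatch` makes it agree with the left-hand one.
  set W : ℝ → ℝ := fun y => (Q ⌊y⌋).eval (y - ⌊y⌋) with hW
  have hcell : ∀ i : ℤ, ∀ t ∈ Icc (0 : ℝ) 1, W (i + t) = (Q i).eval t := by
    intro i t ht
    rcases ht.2.eq_or_lt with rfl | h
    · have : ⌊(i : ℝ) + 1⌋ = i + 1 := by simp
      simp only [hW, this, hmatch]
      simp
    · have : ⌊(i : ℝ) + t⌋ = i := Int.floor_eq_iff.2 ⟨by linarith [ht.1], by linarith⟩
      simp only [hW, this, add_sub_cancel_left]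
  have hWc : Continuous W := by
    refine locallyFinite_Icc_int.continuous ?_ (fun i => isClosed_Icc) fun i => ?_
    · exact eq_univ_of_forall fun y => mem_iUnion.2
        ⟨⌊y⌋, Int.floor_le y, (Int.lt_floor_add_one y).le⟩
    · have : ContinuousOn (fun y : ℝ => (Q i).eval (y - i)) (Icc (i : ℝ) (i + 1)) := by fun_prop
      refine this.congr fun y hy => ?_
      have h := hcell i (y - i) ⟨by linarith [hy.1], by linarith [hy.2]⟩
      rwa [add_sub_cancel] at h
  have hw : ∀ i : ℤ, ∀ t ∈ Icc (0 : ℝ) 1,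
      W (N * (((i : ℝ) + t) / N)) = (Q i).eval t := fun i t ht => by
    rw [mul_div_cancel₀ _ hN'.ne', hcell i t ht]
  refine ⟨fun x => W (N * x), ?_, hw⟩
  rw [mem_femSpace_iff hN]
  refine ⟨by fun_prop, fun x => ?_, fun i => ⟨Q i, hdeg i, hw i⟩⟩
  have : ⌊(N : ℝ) * (x + 1)⌋ = ⌊(N : ℝ) * x⌋ + N := by
    rw [mul_add, mul_one, ← Int.floor_add_natCast]
  simp only [hW, this, hper]
  congr 1
  push_cast
  ring

end femSpace

/-! ### Quasi-interpolation and the bound for odd degree -/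

theorem periodic_iteratedDeriv {u : ℝ → ℝ} {c : ℝ} (hu : Function.Periodic u c) (j : ℕ) :
    Function.Periodic (iteratedDeriv j u) c := by
  intro x
  have h := congrFun (iteratedDeriv_comp_add_const (n := j) (f := u) (s := c)) x
  rw [← h]
  congr 1
  exact funext hu

theorem abs_iteratedDeriv_le_supNorm {r : ℕ} {u : ℝ → ℝ} (hu : u ∈ Cp r) (x : ℝ) :
    |iteratedDeriv r u x| ≤ supNorm (iteratedDeriv r u) := by
  -- A real supremum dominates its terms only when the range is bounded, which continuity and
  -- periodicity supply.
  have hc : Continuous (iteratedDeriv r u) := hu.1.continuous_iteratedDeriv r le_rfl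
  have hb := (periodic_iteratedDeriv hu.2 r).isBounded_of_continuous one_ne_zero hc
  obtain ⟨C, hC⟩ := hb.exists_norm_le
  refine le_ciSup (f := fun x => |iteratedDeriv r u x|) ⟨C, ?_⟩ x
  rintro _ ⟨y, rfl⟩
  exact hC _ ⟨y, rfl⟩

/-- Orthogonality lets `a * L` be added to `f` without changing the pairing with `s`, so only the
size of `f + a * L` matters. -/
theorem abs_integral_cell_le {f s L : ℝ → ℝ} {a c : ℝ} (hf : Continuous f) (hs : Continuous s)
    (hL : Continuous L) (horth : ∫ t in (0 : ℝ)..1, L t * s t = 0)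
    (h : ∀ t ∈ Icc (0 : ℝ) 1, |f t + a * L t| ≤ c) :
    |∫ t in (0 : ℝ)..1, f t * s t| ≤ c * ∫ t in (0 : ℝ)..1, |s t| := by
  have h1 : ∫ t in (0 : ℝ)..1, f t * s t = ∫ t in (0 : ℝ)..1, (f t + a * L t) * s t := by
    have h2 : ∫ t in (0 : ℝ)..1, a * (L t * s t) = 0 := by
      rw [intervalIntegral.integral_const_mul, horth, mul_zero]
    have h3 := intervalIntegral.integral_add (μ := volume) (a := 0) (b := 1)
      (f := fun t => f t * s t) (g := fun t => a * (L t * s t))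
      (Continuous.intervalIntegrable (by fun_prop) _ _)
      (Continuous.intervalIntegrable (by fun_prop) _ _)
    rw [h2, add_zero] at h3
    rw [← h3]
    congr 1
    funext t
    ring
  rw [h1, ← intervalIntegral.integral_const_mul]
  refine (intervalIntegral.abs_integral_le_integral_abs zero_le_one).trans ?_
  refine intervalIntegral.integral_mono_on zero_le_one ?_ ?_ fun t ht => ?_
  · exact Continuous.intervalIntegrable (by fun_prop) _ _
  · exact Continuous.intervalIntegrable (by fun_prop) _ _
  · rw [abs_mul]
    exact mul_le_mul_of_nonneg_right (h t ht) (abs_nonneg _)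

open Polynomial in
/-- For odd `k`, a smooth periodic function agrees up to `O(h ^ (k + 2))` with an element of the
finite element space plus multiples of the Legendre polynomial of degree `k + 1` on the cells. -/
theorem exists_quasi_interpolant {k : ℕ} (hk : Odd k) :
    ∃ L : ℝ[X], (∀ p : ℝ[X], p.natDegree ≤ k → ∫ t in (0 : ℝ)..1, L.eval t * p.eval t = 0) ∧
      ∃ C : ℝ, 0 < C ∧ ∀ N : ℕ, 0 < N → ∀ u ∈ Cp (k + 2), ∃ w ∈ femSpace N k, ∀ i : ℤ, ∃ a : ℝ,
        ∀ t ∈ Icc (0 : ℝ) 1, |w (((i : ℝ) + t) / N) - u (((i : ℝ) + t) / N) + a * L.eval t| ≤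
          C * ((1 / (N : ℝ)) ^ (k + 2) * supNorm (iteratedDeriv (k + 2) u)) := by
  obtain ⟨L, hLdeg, hLc, hL01, hLorth⟩ := exists_legendre (n := k + 1) hk.add_one
  refine ⟨L, fun p hp => hLorth p (lt_of_le_of_lt degree_le_natDegree
    (by exact_mod_cast Nat.lt_succ_of_le hp)), 2 + |L.eval 0|, by positivity, ?_⟩
  intro N hN u hu
  have hN' : (0 : ℝ) < N := by exact_mod_cast hN
  -- Cells get unit length, and the power h^(k+2) appears as the scaling of the top derivative.
  set U : ℝ → ℝ := fun t => u ((1 / N : ℝ) * t) with hU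
  set B : ℝ := (1 / (N : ℝ)) ^ (k + 2) * supNorm (iteratedDeriv (k + 2) u) with hB
  have hUc : ContDiff ℝ (k + 2 : ℕ) U := by
    have : ContDiff ℝ (k + 2 : ℕ) fun t : ℝ => (1 / N : ℝ) * t := by fun_prop
    exact hu.1.comp this
  have hUp : Function.Periodic U N := by
    intro t
    have : (1 / N : ℝ) * (t + N) = (1 / N : ℝ) * t + 1 := by
      field_simp
    simp only [hU, this, hu.2 _]
  have hUB : ∀ x, |iteratedDeriv (k + 1 + 1) U x| ≤ B := by
    intro x
    have := congrFun (iteratedDeriv_comp_const_mul (n := k + 2) hu.1 (1 / N : ℝ)) x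
    rw [show k + 1 + 1 = k + 2 from rfl, hU, this, hB, abs_mul, abs_of_nonneg (by positivity)]
    gcongr
    exact abs_iteratedDeriv_le_supNorm hu _
  have hB0 : 0 ≤ B := (abs_nonneg _).trans (hUB 0)
  set D : ℕ → ℤ → ℝ := fun j i => iteratedDeriv j U i / j.factorial with hD
  have hDp : ∀ j i, D j (i + N) = D j i := by
    intro j i
    have := periodic_iteratedDeriv hUp j i
    simp only [hD]
    push_cast
    rw [this]
  set T : ℤ → ℝ → ℝ := fun i t => ∑ j ∈ Finset.range (k + 1 + 1), D j i * t ^ j with hT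
  have hTaylor : ∀ i : ℤ, ∀ t ∈ Icc (0 : ℝ) 1, |U (i + t) - T i t| ≤ B := by
    intro i t ht
    refine (abs_sub_taylor_le hUc hUB i ht.1).trans ?_
    exact mul_le_of_le_one_right hB0 (pow_le_one₀ ht.1 ht.2)
  have ha : ∀ i : ℤ, |D (k + 1) (i + 1) - D (k + 1) i| ≤ B := by
    intro i
    have h1 := Convex.norm_image_sub_le_of_norm_deriv_le (f := iteratedDeriv (k + 1) U) (C := B)
      (s := univ) (x := (i : ℝ)) (y := i + 1)
      (fun x _ => (hUc.differentiable_iteratedDeriv (k + 1)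
        (by exact_mod_cast Nat.lt_succ_self _)).differentiableAt)
      (fun x _ => by rw [← iteratedDeriv_succ]; exact hUB x) convex_univ trivial trivial
    simp only [Real.norm_eq_abs, add_sub_cancel_left, abs_one, mul_one] at h1
    simp only [hD]
    push_cast
    rw [← sub_div, abs_div, Nat.abs_cast]
    refine (div_le_self (abs_nonneg _) ?_).trans h1
    exact_mod_cast Nat.factorial_pos _
  -- The jump at node `i + 1` before correction. Because L(0) = L(1), only the difference of
  -- consecutive leading Taylor coefficients enters, and that is of remainder size.
  set δ : ℤ → ℝ := fun i => U (i + 1) - T i 1 - (D (k + 1) (i + 1) - D (k + 1) i) * L.eval 0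
    with hδ
  have hδb : ∀ i, |δ i| ≤ B + B * |L.eval 0| := by
    intro i
    refine (abs_sub _ _).trans (add_le_add (hTaylor i 1 ⟨zero_le_one, le_rfl⟩) ?_)
    rw [abs_mul]
    exact mul_le_mul_of_nonneg_right (ha i) (abs_nonneg _)
  -- The Taylor polynomial of degree k+1 minus its leading coefficient times `L`, plus `δ i * t`. As
  -- `L` is monic the degree drops to `k`; the linear term closes the jump and vanishes at the left
  -- end.
  set Q : ℤ → ℝ[X] := fun i => ∑ j ∈ Finset.range (k + 1), C (D j i) * X ^ j -
    C (D (k + 1) i) * (L - X ^ (k + 1)) + C (δ i) * X with hQ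
  have hQe : ∀ i t, (Q i).eval t = T i t - D (k + 1) i * L.eval t + δ i * t := by
    intro i t
    simp only [hQ, hT, eval_add, eval_sub, eval_mul, eval_C, eval_X, eval_pow, eval_finsetSum,
      Finset.sum_range_succ _ (k + 1)]
    ring
  have hT0 : ∀ i, T i 0 = U i := by
    intro i
    simp [hT, hD, Finset.sum_range_succ']
  have hdeg : ∀ i, (Q i).natDegree ≤ k := by
    intro i
    have hLX : (L - X ^ (k + 1)).natDegree ≤ k := by
      rw [natDegree_le_iff_coeff_eq_zero]
      intro n hn
      rcases (show k + 1 ≤ n from hn).eq_or_lt with rfl | h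
      · simp [hLc]
      · rw [coeff_sub, coeff_eq_zero_of_natDegree_lt (lt_of_le_of_lt hLdeg h), coeff_X_pow,
          if_neg h.ne', sub_zero]
    refine natDegree_add_le_of_degree_le (natDegree_sub_le_of_le (m := k) (n := k) ?_ ?_ |>.trans ?_) ?_
    · refine natDegree_sum_le_of_forall_le _ _ fun j hj => ?_
      refine (natDegree_C_mul_X_pow_le _ _).trans ?_
      have := Finset.mem_range.1 hj
      omega
    · exact (natDegree_C_mul_le _ _).trans hLX
    · simp
    · exact (natDegree_C_mul_le _ _).trans (natDegree_X_le.trans hk.pos)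
  have hmatch : ∀ i, (Q i).eval 1 = (Q (i + 1)).eval 0 := by
    intro i
    rw [hQe, hQe, hT0, ← hL01]
    simp only [hδ]
    push_cast
    ring
  have hper : ∀ i, Q (i + N) = Q i := by
    intro i
    have hTp : T (i + N) 1 = T i 1 := by simp only [hT, hDp]
    have hUi : U ((i + N : ℤ) + 1) = U (i + 1) := by
      rw [← hUp (i + 1)]
      congr 1
      push_cast
      ring
    have hδp : δ (i + N) = δ i := by
      simp only [hδ, hTp, hUi, hDp]
      rw [show i + (N : ℤ) + 1 = i + 1 + N by ring, hDp]
    simp only [hQ, hDp, hδp]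
  obtain ⟨w, hw, hwQ⟩ := exists_mem_femSpace_of_pieces (k := k) hN (Q := Q) hdeg hmatch hper
  refine ⟨w, hw, fun i => ⟨D (k + 1) i, fun t ht => ?_⟩⟩
  have hUt : u (((i : ℝ) + t) / N) = U (i + t) := by
    simp only [hU]
    congr 1
    ring
  rw [hwQ i t ht, hUt, hQe]
  calc |T i t - D (k + 1) i * L.eval t + δ i * t - U (i + t) + D (k + 1) i * L.eval t|
      = |δ i * t - (U (i + t) - T i t)| := by
        congr 1
        ring
    _ ≤ |δ i * t| + |U (i + t) - T i t| := abs_sub _ _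
    _ ≤ (B + B * |L.eval 0|) * 1 + B := by
        rw [abs_mul, abs_of_nonneg ht.1]
        exact add_le_add (mul_le_mul (hδb i) ht.2 ht.1 (by positivity)) (hTaylor i t ht)
    _ = (2 + |L.eval 0|) * B := by ring

/-- The pairing of the quasi-interpolation error with a function that is a polynomial of degree at
most `k` inside each cell. -/
theorem exists_abs_integral_quasi_interpolant_le {k : ℕ} (hk : Odd k) :
    ∃ C : ℝ, 0 < C ∧ ∀ N : ℕ, 0 < N → ∀ u ∈ Cp (k + 2), ∃ w ∈ femSpace N k, ∀ ψ : ℝ → ℝ, IsL2 ψ →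
      (∀ i : ℤ, ∃ s : Polynomial ℝ, s.natDegree ≤ k ∧
        ∀ t ∈ Ioo (0 : ℝ) 1, ψ (((i : ℝ) + t) / N) = s.eval t) →
      |∫ x in (0 : ℝ)..1, (w x - u x) * ψ x| ≤
        C * ((1 / (N : ℝ)) ^ (k + 2) * supNorm (iteratedDeriv (k + 2) u)) * l2Norm ψ := by
  obtain ⟨L, hL, C, hC, h⟩ := exists_quasi_interpolant hk
  refine ⟨C, hC, fun N hN u hu => ?_⟩
  have hN' : (0 : ℝ) < N := by exact_mod_cast hN
  obtain ⟨w, hw, hwu⟩ := h N hN u hu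
  refine ⟨w, hw, fun ψ hψ hψs => ?_⟩
  choose a ha using hwu
  choose s hs hst using hψs
  set c := C * ((1 / (N : ℝ)) ^ (k + 2) * supNorm (iteratedDeriv (k + 2) u)) with hc
  have hc0 : 0 ≤ c := (abs_nonneg _).trans (ha 0 0 ⟨le_rfl, zero_le_one⟩)
  have hcont : Continuous fun x => w x - u x := hw.1.sub hu.1.continuous
  refine le_trans ?_ (mul_le_mul_of_nonneg_left (integral_abs_le_l2Norm hψ) hc0)
  rw [integral_eq_sum_cells hN ((isL2_of_continuous hcont).intervalIntegrable_mul hψ),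
    integral_eq_sum_cells hN hψ.abs.intervalIntegrable, abs_mul, abs_of_nonneg (by positivity),
    mul_left_comm]
  gcongr
  rw [Finset.mul_sum]
  refine (Finset.abs_sum_le_sum_abs _ _).trans (Finset.sum_le_sum fun i _ => ?_)
  rw [integral_cell_congr (f := fun t => |ψ ((((i : ℤ) : ℝ) + t) / N)|)
      (g := fun t => |(s i).eval t|) (fun t ht => by rw [hst i t ht]),
    integral_cell_congr (g := fun t => (w ((((i : ℤ) : ℝ) + t) / N) - u ((((i : ℤ) : ℝ) + t) / N)) *
      (s i).eval t) (fun t ht => by rw [hst i t ht])]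
  refine abs_integral_cell_le (a := a i) (hcont.comp (by fun_prop)) (s i).continuous L.continuous
    (hL _ (hs i)) (ha i)

/-- As `g` lies in the space, the outer projection drops out when tested with `g`; integration by
parts has no boundary terms by periodicity. -/
theorem integral_l2Proj_mul_self {N k r : ℕ} (hN : 0 < N) {u : ℝ → ℝ} (hu : u ∈ Cp (r + 1)) :
    let g := l2Proj N k (errDeriv N k u)
    ∫ x in (0 : ℝ)..1, g x * g x = -∫ x in (0 : ℝ)..1, (l2Proj N k u x - u x) * deriv g x := by
  intro g
  have hg := l2Proj_spec hN k (isL2_errDeriv hN k r hu)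
  have hw := l2Proj_spec hN k (isL2_of_continuous hu.1.continuous)
  have hud : Differentiable ℝ u := hu.1.differentiable (by simp)
  rw [hg.2 g hg.1]
  exact integral_deriv_mul_eq_neg (countable_nodes N) (hw.1.1.sub hu.1.continuous) hg.1.1
    (hw.1.2.1.sub hu.2) hg.1.2.1
    (fun x hx => (differentiableAt_of_mem_femSpace hN hw.1 hx).sub (hud x))
    (fun x hx => differentiableAt_of_mem_femSpace hN hg.1 hx)
    (isL2_errDeriv hN k r hu) (isL2_deriv hN hg.1)

theorem exists_l2Norm_le_of_odd {k : ℕ} (hk : Odd k) :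
    ∃ C : ℝ, 0 < C ∧ ∀ N : ℕ, 0 < N → ∀ u ∈ Cp (k + 2),
      l2Norm (l2Proj N k (errDeriv N k u)) ≤
        C * (1 / (N : ℝ)) ^ (k + 1) * supNorm (iteratedDeriv (k + 2) u) := by
  obtain ⟨C, hC, h⟩ := exists_abs_integral_quasi_interpolant_le hk
  obtain ⟨K, hK, hinv⟩ := exists_l2Norm_deriv_le k
  refine ⟨2 * C * K, by positivity, fun N hN u hu => ?_⟩
  have hN' : (0 : ℝ) < N := by exact_mod_cast hN
  obtain ⟨w, hw, hwψ⟩ := h N hN u hu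
  set A := supNorm (iteratedDeriv (k + 2) u) with hA
  have hA0 : 0 ≤ A := (abs_nonneg _).trans (abs_iteratedDeriv_le_supNorm hu 0)
  set B := (1 / (N : ℝ)) ^ (k + 2) * A with hB
  have hB0 : 0 ≤ B := by positivity
  have hu2 := isL2_of_continuous hu.1.continuous
  have hP := l2Proj_spec hN k hu2
  have hg := (l2Proj_spec hN k (isL2_errDeriv hN k (k + 1) hu)).1
  have hgg := integral_l2Proj_mul_self (k := k) (r := k + 1) hN hu
  set P := l2Proj N k u
  set g := l2Proj N k (errDeriv N k u)
  have hv : (fun x => P x - w x) ∈ femSpace N k := (femSpace N k).sub_mem hP.1 hw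
  have hg2 := isL2_deriv hN hg
  -- Pu - u is orthogonal to v = Pu - w, so ‖v‖² = -∫ (w - u) v, to which the pairing bound applies.
  have hvnorm : l2Norm (fun x => P x - w x) ≤ C * B := by
    refine l2Norm_le_of_sq_le (by positivity) ?_
    have h1 := hwψ _ (isL2_of_continuous hv.1) fun i => by
      obtain ⟨q, hq, hqt⟩ := ((mem_femSpace_iff hN).1 hv).2.2 i
      exact ⟨q, hq, fun t ht => hqt t ⟨ht.1.le, ht.2.le⟩⟩
    refine le_trans (le_of_eq ?_) ((neg_le_abs _).trans h1)
    have h2 := hP.2 _ hv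
    have hP2 := isL2_of_continuous hP.1.1
    have hw2 := isL2_of_continuous hw.1
    have hv2 := isL2_of_continuous hv.1
    rw [integral_sub_mul hP2 hw2 hv2, integral_sub_mul hw2 hu2 hv2, h2]
    ring
  -- The derivative of `g` may jump at nodes, which the pairing bound allows.
  have hwg := hwψ _ hg2 fun i => by
    obtain ⟨q, hq, hqt⟩ := ((mem_femSpace_iff hN).1 hg).2.2 i
    refine ⟨Polynomial.C (N : ℝ) * q.derivative, ?_, fun t ht => ?_⟩
    · exact (Polynomial.natDegree_C_mul_le _ _).trans
        ((Polynomial.natDegree_derivative_le _).trans (by omega))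
    · rw [(hasDerivAt_of_cell hN hqt ht).deriv]
      simp
  have hvg := abs_integral_mul_le (isL2_of_continuous hv.1) hg2
  have hsplit : ∫ x in (0 : ℝ)..1, (P x - u x) * deriv g x =
      (∫ x in (0 : ℝ)..1, (w x - u x) * deriv g x) +
        ∫ x in (0 : ℝ)..1, (P x - w x) * deriv g x := by
    rw [← integral_add_mul (f := fun x => w x - u x)
      (isL2_of_continuous (hw.1.sub hu.1.continuous)) (isL2_of_continuous hv.1) hg2]
    congr 1
    funext x
    ring
  have hfin : l2Norm g ≤ 2 * C * B * (K * N) := by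
    refine l2Norm_le_of_sq_le (by positivity) ?_
    have h0 := l2Norm_nonneg (deriv g)
    calc ∫ x in (0 : ℝ)..1, g x * g x ≤ C * B * l2Norm (deriv g) + C * B * l2Norm (deriv g) := by
          rw [hgg, hsplit, neg_add]
          refine add_le_add ((neg_le_abs _).trans hwg) ((neg_le_abs _).trans (hvg.trans ?_))
          gcongr
      _ = 2 * C * B * l2Norm (deriv g) := by ring
      _ ≤ 2 * C * B * (K * N * l2Norm g) := by
          gcongr
          exact hinv N hN g hg
      _ = _ := by ring
  refine hfin.trans_eq ?_
  rw [hB, pow_succ _ (k + 1)]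
  field_simp

/-! ### Piecewise linear elements: Simpson mean and centred difference -/

theorem integral_comp_add_mul {f g : ℝ → ℝ} (hf : Function.Periodic f 1)
    (hg : Function.Periodic g 1) (c : ℝ) :
    ∫ x in (0 : ℝ)..1, f (x + c) * g x = ∫ x in (0 : ℝ)..1, f x * g (x - c) := by
  have h1 := intervalIntegral.integral_comp_add_right (a := 0) (b := 1)
    (fun x => f x * g (x - c)) c
  simp only [add_sub_cancel_right] at h1
  have h2 : Function.Periodic (fun x => f x * g (x - c)) 1 := hf.mul (hg.sub_const c)
  have h3 := h2.intervalIntegral_add_eq c 0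
  rw [h1, zero_add, add_comm 1 c, h3, zero_add]

/-- Simpson's rule applied to `u'`. -/
theorem abs_simpson_le {u : ℝ → ℝ} (hu : ContDiff ℝ 5 u) {A : ℝ}
    (hA : ∀ x, |iteratedDeriv 5 u x| ≤ A) {h : ℝ} (hh : 0 < h) (x : ℝ) :
    |(u (x + h) - u (x - h)) / (2 * h) -
      (deriv u (x - h) + 4 * deriv u x + deriv u (x + h)) / 6| ≤ 20 * h ^ 4 * A := by
  have hd : ContDiff ℝ (3 + 1 : ℕ) (deriv u) := by
    have h5 : ContDiff ℝ (4 + 1) u := by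
      norm_num
      exact hu
    exact (contDiff_succ_iff_deriv.1 h5).2.2
  have hdA : ∀ x, |iteratedDeriv (3 + 1) (deriv u) x| ≤ A := fun x => by
    rw [← iteratedDeriv_succ']
    exact hA x
  have hj : ∀ j, iteratedDeriv j (deriv u) = iteratedDeriv (j + 1) u := fun j =>
    iteratedDeriv_succ'.symm
  -- All expansions are about x - h. Simpson's rule is exact on cubics, so the Taylor terms cancel.
  -- After multiplication by 2h the remainders total (32 + 4/3 + 16/3) h⁵A, below the 40 h⁵A
  -- allowed.
  have t0 := abs_sub_taylor_le (n := 4) (by exact_mod_cast hu) hA (x - h)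
    (show 0 ≤ 2 * h by positivity)
  have t1 := abs_sub_taylor_le (n := 3) hd hdA (x - h) hh.le
  have t2 := abs_sub_taylor_le (n := 3) hd hdA (x - h) (show 0 ≤ 2 * h by positivity)
  rw [show x - h + 2 * h = x + h by ring] at t0 t2
  rw [sub_add_cancel] at t1
  simp only [hj, Finset.sum_range_succ, Finset.sum_range_zero, Nat.factorial] at t0 t1 t2
  norm_num [iteratedDeriv_one, iteratedDeriv_zero] at t0 t1 t2
  have hq : (u (x + h) - u (x - h)) / (2 * h) =
      (u (x + h) - u (x - h)) * (1 / (2 * h)) := by ring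
  rw [← sub_nonneg, ← mul_nonneg_iff_of_pos_left (show 0 < 2 * h by positivity), mul_sub,
    sub_nonneg, ← abs_of_pos (show 0 < 2 * h by positivity), ← abs_mul,
    abs_of_pos (show 0 < 2 * h by positivity), mul_sub, mul_div_cancel₀ _ (by positivity)]
  rw [abs_le] at t0 t1 t2 ⊢
  have e1 := mul_le_mul_of_nonneg_left t1.1 hh.le
  have e2 := mul_le_mul_of_nonneg_left t1.2 hh.le
  have e3 := mul_le_mul_of_nonneg_left t2.1 hh.le
  have e4 := mul_le_mul_of_nonneg_left t2.2 hh.le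
  have hA0 : 0 ≤ h ^ 5 * A := mul_nonneg (by positivity) ((abs_nonneg _).trans (hA 0))
  constructor <;> nlinarith [t0.1, t0.2]

section piecewiseLinear

variable {N : ℕ} {w χ : ℝ → ℝ}

theorem comp_add_inv_mem_femSpace {k : ℕ} (hN : 0 < N) (hw : w ∈ femSpace N k) :
    (fun x => w (x + 1 / N)) ∈ femSpace N k ∧ (fun x => w (x - 1 / N)) ∈ femSpace N k := by
  refine ⟨by simpa using comp_add_mem_femSpace hN hw 1, ?_⟩
  simpa [neg_div, sub_eq_add_neg] using comp_add_mem_femSpace hN hw (-1)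

theorem simpsonMean_mem_femSpace {k : ℕ} (hN : 0 < N) (hw : w ∈ femSpace N k) :
    (fun x => (w (x - 1 / N) + 4 * w x + w (x + 1 / N)) / 6) ∈ femSpace N k := by
  obtain ⟨h1, h2⟩ := comp_add_inv_mem_femSpace hN hw
  have := (femSpace N k).smul_mem (1 / 6 : ℝ) ((femSpace N k).add_mem ((femSpace N k).add_mem
    h2 ((femSpace N k).smul_mem (4 : ℝ) hw)) h1)
  convert this using 1
  funext x
  simp only [Pi.smul_apply, Pi.add_apply, smul_eq_mul]
  ring

theorem centredDiff_mem_femSpace {k : ℕ} (hN : 0 < N) (hw : w ∈ femSpace N k) :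
    (fun x => (w (x + 1 / N) - w (x - 1 / N)) / (2 * (1 / N))) ∈ femSpace N k := by
  obtain ⟨h1, h2⟩ := comp_add_inv_mem_femSpace hN hw
  have := (femSpace N k).smul_mem (N / 2 : ℝ) ((femSpace N k).sub_mem h1 h2)
  convert this using 1
  funext x
  simp only [Pi.smul_apply, Pi.sub_apply, smul_eq_mul]
  field_simp

theorem exists_cell_affine (hN : 0 < N) (hw : w ∈ femSpace N 1) (i : ℤ) :
    (∀ t ∈ Icc (0 : ℝ) 1, w (((i : ℝ) + t) / N) =
      w ((i : ℝ) / N) + (w (((i : ℝ) + 1) / N) - w ((i : ℝ) / N)) * t) ∧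
    ∀ t ∈ Ioo (0 : ℝ) 1, deriv w (((i : ℝ) + t) / N) =
      N * (w (((i : ℝ) + 1) / N) - w ((i : ℝ) / N)) := by
  obtain ⟨q, hq, hqt⟩ := ((mem_femSpace_iff hN).1 hw).2.2 i
  obtain ⟨a, b, rfl⟩ := Polynomial.exists_eq_X_add_C_of_natDegree_le_one hq
  have h0 := hqt 0 ⟨le_rfl, zero_le_one⟩
  have h1 := hqt 1 ⟨zero_le_one, le_rfl⟩
  simp only [add_zero, Polynomial.eval_add, Polynomial.eval_mul, Polynomial.eval_C,
    Polynomial.eval_X] at h0 h1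
  refine ⟨fun t ht => ?_, fun t ht => ?_⟩
  · rw [hqt t ht, h0, h1]
    simp
    ring
  · rw [(hasDerivAt_of_cell hN hqt ht).deriv, h0, h1]
    simp

theorem integral_deriv_mul_eq_sum (hN : 0 < N) (hw : w ∈ femSpace N 1) (hχ : χ ∈ femSpace N 1) :
    ∫ x in (0 : ℝ)..1, deriv w x * χ x = ∑ i ∈ Finset.range N,
      (w ((i + 1) / N) - w (i / N)) * (χ (i / N) + χ ((i + 1) / N)) / 2 := by
  have hN' : (0 : ℝ) < N := by exact_mod_cast hN
  rw [integral_eq_sum_cells hN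
    ((isL2_deriv hN hw).intervalIntegrable_mul (isL2_of_continuous hχ.1)), Finset.mul_sum]
  refine Finset.sum_congr rfl fun i _ => ?_
  obtain ⟨-, h1⟩ := exists_cell_affine hN hw i
  obtain ⟨h2, -⟩ := exists_cell_affine hN hχ i
  rw [integral_cell_congr (fun t ht => by rw [h1 t ht, h2 t ⟨ht.1.le, ht.2.le⟩])]
  simp only [Int.cast_natCast]
  rw [intervalIntegral.integral_const_mul, intervalIntegral.integral_add (by simp)
    (Continuous.intervalIntegrable (by fun_prop) _ _), intervalIntegral.integral_const_mul]
  simp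
  field_simp
  ring

theorem integral_mul_eq_sum (hN : 0 < N) (hw : w ∈ femSpace N 1) (hχ : χ ∈ femSpace N 1) :
    ∫ x in (0 : ℝ)..1, w x * χ x = (N : ℝ)⁻¹ * ∑ i ∈ Finset.range N,
      (2 * (w (i / N) * χ (i / N)) + 2 * (w ((i + 1) / N) * χ ((i + 1) / N)) +
        w (i / N) * χ ((i + 1) / N) + w ((i + 1) / N) * χ (i / N)) / 6 := by
  rw [integral_eq_sum_cells hN
    ((isL2_of_continuous hw.1).intervalIntegrable_mul (isL2_of_continuous hχ.1))]
  congr 1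
  refine Finset.sum_congr rfl fun i _ => ?_
  obtain ⟨h1, -⟩ := exists_cell_affine hN hw i
  obtain ⟨h2, -⟩ := exists_cell_affine hN hχ i
  rw [integral_cell_congr
    (fun t ht => by rw [h1 t ⟨ht.1.le, ht.2.le⟩, h2 t ⟨ht.1.le, ht.2.le⟩])]
  simp only [Int.cast_natCast]
  generalize w (i / N) = a, w ((i + 1) / N) = b, χ (i / N) = c, χ ((i + 1) / N) = d
  have h : ∀ x : ℝ, HasDerivAt
      (fun t : ℝ => a * c * t + (a * (d - c) + (b - a) * c) * t ^ 2 / 2 +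
        (b - a) * (d - c) * t ^ 3 / 3) ((a + (b - a) * x) * (c + (d - c) * x)) x := by
    intro x
    have e1 := (hasDerivAt_id x).const_mul (a * c)
    have e2 := (((hasDerivAt_pow 2 x).const_mul (a * (d - c) + (b - a) * c))).div_const 2
    have e3 := (((hasDerivAt_pow 3 x).const_mul ((b - a) * (d - c)))).div_const 3
    refine ((e1.add e2).add e3).congr_deriv ?_
    push_cast
    ring
  rw [intervalIntegral.integral_eq_sub_of_hasDerivAt (fun x _ => h x)
    (Continuous.intervalIntegrable (by fun_prop) _ _)]
  ring

/-- On piecewise linear functions, the centred difference quotient is adjoint to the derivative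
composed with the Simpson mean. -/
theorem integral_deriv_mul_simpson (hN : 0 < N) (hw : w ∈ femSpace N 1) (hχ : χ ∈ femSpace N 1) :
    ∫ x in (0 : ℝ)..1, deriv w x * ((χ (x - 1 / N) + 4 * χ x + χ (x + 1 / N)) / 6) =
      ∫ x in (0 : ℝ)..1, (w (x + 1 / N) - w (x - 1 / N)) / (2 * (1 / N)) * χ x := by
  have hN' : (0 : ℝ) < N := by exact_mod_cast hN
  have hM := simpsonMean_mem_femSpace hN hχ
  have hD := centredDiff_mem_femSpace hN hw
  rw [integral_deriv_mul_eq_sum hN hw hM, integral_mul_eq_sum hN hD hχ, Finset.mul_sum,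
    ← sub_eq_zero, ← Finset.sum_sub_distrib]
  set W : ℝ → ℝ := fun y => w (y / N) with hW
  set X : ℝ → ℝ := fun y => χ (y / N) with hX
  -- Summation by parts: the i-th summands of the two sides differ by (F(i+1) - F(i))/12, and the
  -- telescoped total vanishes since F(N) = F(0).
  set F : ℝ → ℝ := fun i => -(W (i + 1) * X (i - 1)) + W i * X (i - 1) - 2 * (W (i + 1) * X i) +
    4 * (W i * X i) + W i * X (i + 1) - 2 * (W (i - 1) * X i) - W (i - 1) * X (i + 1) with hF
  have hFp : F N = F 0 := by
    have hp : ∀ {φ : ℝ → ℝ}, Function.Periodic φ 1 → ∀ y : ℝ, φ ((N + y) / N) = φ (y / N) :=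
      fun {φ} hφ y => by rw [add_div, div_self hN'.ne', add_comm, hφ]
    have h0 := fun y => hp hw.2.1 y
    have h1 := fun y => hp hχ.2.1 y
    have a0 := h0 0
    have b0 := h1 0
    rw [add_zero] at a0 b0
    simp only [hF, hW, hX, sub_eq_add_neg, h0, h1, a0, b0, zero_add]
  have htel := Finset.sum_range_sub (fun i : ℕ => F i / 12) N
  simp only [Nat.cast_zero, hFp, sub_self] at htel
  rw [← htel]
  refine Finset.sum_congr rfl fun i _ => ?_
  have a1 : ∀ y : ℝ, w (y / N + 1 / N) = W (y + 1) := fun y => by simp only [hW, add_div]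
  have a2 : ∀ y : ℝ, w (y / N - 1 / N) = W (y - 1) := fun y => by simp only [hW, sub_div]
  have a3 : ∀ y : ℝ, w (y / N) = W y := fun y => rfl
  have b1 : ∀ y : ℝ, χ (y / N + 1 / N) = X (y + 1) := fun y => by simp only [hX, add_div]
  have b2 : ∀ y : ℝ, χ (y / N - 1 / N) = X (y - 1) := fun y => by simp only [hX, sub_div]
  have b3 : ∀ y : ℝ, χ (y / N) = X y := fun y => rfl
  simp only [a1, a2, a3, b1, b2, b3, hF]
  push_cast
  simp only [add_sub_cancel_right]
  field_simp
  ring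

end piecewiseLinear

/-- Translations are adjoint to their inverses on periodic functions, so the centred difference is
skew-adjoint; likewise the symmetric Simpson mean is self-adjoint. -/
theorem integral_centredDiff_mul {f g : ℝ → ℝ} (hf : Continuous f) (hfp : Function.Periodic f 1)
    (hg : Continuous g) (hgp : Function.Periodic g 1) (h : ℝ) :
    ∫ x in (0 : ℝ)..1, (f (x + h) - f (x - h)) / (2 * h) * g x =
      ∫ x in (0 : ℝ)..1, f x * ((g (x - h) - g (x + h)) / (2 * h)) := by
  have h1 := integral_comp_add_mul hfp hgp h
  have h2 := integral_comp_add_mul hfp hgp (-h)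
  simp only [sub_neg_eq_add, ← sub_eq_add_neg] at h2
  have e1 : ∀ x, (f (x + h) - f (x - h)) / (2 * h) * g x =
      (2 * h)⁻¹ * (f (x + h) * g x - f (x - h) * g x) := fun x => by ring
  have e2 : ∀ x, f x * ((g (x - h) - g (x + h)) / (2 * h)) =
      (2 * h)⁻¹ * (f x * g (x - h) - f x * g (x + h)) := fun x => by ring
  simp only [e1, e2, intervalIntegral.integral_const_mul]
  rw [intervalIntegral.integral_sub (Continuous.intervalIntegrable (by fun_prop) _ _)
      (Continuous.intervalIntegrable (by fun_prop) _ _),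
    intervalIntegral.integral_sub (Continuous.intervalIntegrable (by fun_prop) _ _)
      (Continuous.intervalIntegrable (by fun_prop) _ _), h1, h2]

theorem integral_mul_simpsonMean {f g : ℝ → ℝ} (hf : Continuous f) (hfp : Function.Periodic f 1)
    (hg : Continuous g) (hgp : Function.Periodic g 1) (h : ℝ) :
    ∫ x in (0 : ℝ)..1, f x * ((g (x - h) + 4 * g x + g (x + h)) / 6) =
      ∫ x in (0 : ℝ)..1, (f (x - h) + 4 * f x + f (x + h)) / 6 * g x := by
  have h1 := integral_comp_add_mul hfp hgp h
  have h2 := integral_comp_add_mul hfp hgp (-h)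
  simp only [sub_neg_eq_add, ← sub_eq_add_neg] at h2
  have e1 : ∀ x, f x * ((g (x - h) + 4 * g x + g (x + h)) / 6) =
      6⁻¹ * (f x * g (x - h) + 4 * (f x * g x) + f x * g (x + h)) := fun x => by ring
  have e2 : ∀ x, (f (x - h) + 4 * f x + f (x + h)) / 6 * g x =
      6⁻¹ * (f (x - h) * g x + 4 * (f x * g x) + f (x + h) * g x) := fun x => by ring
  have i1 : ∀ {a b : ℝ → ℝ}, Continuous a → Continuous b →
      IntervalIntegrable (fun x => a x * b x) volume 0 1 := fun ha hb =>
    (isL2_of_continuous ha).intervalIntegrable_mul (isL2_of_continuous hb)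
  have hgm : Continuous fun x => g (x - h) := by fun_prop
  have hgp' : Continuous fun x => g (x + h) := by fun_prop
  have hfm : Continuous fun x => f (x - h) := by fun_prop
  have hfp' : Continuous fun x => f (x + h) := by fun_prop
  have i3 := (i1 hf hg).const_mul 4
  simp only [e1, e2, intervalIntegral.integral_const_mul]
  rw [intervalIntegral.integral_add ((i1 hf hgm).add i3) (i1 hf hgp'),
    intervalIntegral.integral_add (i1 hf hgm) i3,
    intervalIntegral.integral_add ((i1 hfm hg).add i3) (i1 hfp' hg),
    intervalIntegral.integral_add (i1 hfm hg) i3, h1, h2]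
  ring

/-- The Simpson mean is coercive. -/
theorem integral_sq_le_simpsonMean {g : ℝ → ℝ} (hg : Continuous g) (hgp : Function.Periodic g 1)
    (h : ℝ) : ∫ x in (0 : ℝ)..1, g x * g x ≤
      3 * ∫ x in (0 : ℝ)..1, g x * ((g (x - h) + 4 * g x + g (x + h)) / 6) := by
  have hshift : ∀ c : ℝ, ∫ x in (0 : ℝ)..1, g (x + c) * g (x + c) =
      ∫ x in (0 : ℝ)..1, g x * g x := fun c => by
    have := integral_comp_add_mul hgp (hgp.add_const c) c
    simpa only [sub_add_cancel] using this
  have i1 : ∀ c : ℝ, IntervalIntegrable (fun x => g (x + c) * g (x + c)) volume 0 1 := fun c =>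
    Continuous.intervalIntegrable (by fun_prop) _ _
  have i0 : IntervalIntegrable (fun x => 6 * (g x * g x)) volume 0 1 :=
    Continuous.intervalIntegrable (by fun_prop) _ _
  have hlow : ∫ x in (0 : ℝ)..1, (6 * (g x * g x) - g (x + -h) * g (x + -h) -
      g (x + h) * g (x + h)) ≤
      ∫ x in (0 : ℝ)..1, 12 * (g x * ((g (x - h) + 4 * g x + g (x + h)) / 6)) := by
    refine intervalIntegral.integral_mono_on zero_le_one ((i0.sub (i1 _)).sub (i1 _))
      (Continuous.intervalIntegrable (by fun_prop) _ _) fun x _ => ?_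
    rw [← sub_eq_add_neg]
    -- Each cross term satisfies 2ab ≥ -a² - b². By translation invariance 4∫g² survives against
    -- 12∫g Mg, hence the factor 3.
    nlinarith [sq_nonneg (g x + g (x - h)), sq_nonneg (g x + g (x + h))]
  rw [intervalIntegral.integral_sub (i0.sub (i1 _)) (i1 _), intervalIntegral.integral_sub i0 (i1 _),
    hshift, hshift, intervalIntegral.integral_const_mul,
    intervalIntegral.integral_const_mul] at hlow
  linarith

theorem l2Norm_le_of_piecewiseLinear {N : ℕ} (hN : 0 < N) {u : ℝ → ℝ} (hu : u ∈ Cp 5) :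
    l2Norm (l2Proj N 1 (errDeriv N 1 u)) ≤
      60 * (1 / (N : ℝ)) ^ 4 * supNorm (iteratedDeriv 5 u) := by
  have hN' : (0 : ℝ) < N := by exact_mod_cast hN
  have hA := abs_iteratedDeriv_le_supNorm hu
  set A := supNorm (iteratedDeriv 5 u)
  have hA0 : 0 ≤ A := (abs_nonneg _).trans (hA 0)
  have herr := isL2_errDeriv hN 1 4 hu
  have hP := l2Proj_spec hN 1 (isL2_of_continuous hu.1.continuous)
  have hg := l2Proj_spec hN 1 herr
  have herr_eq : ∀ x ∉ nodes N, errDeriv N 1 u x = deriv (l2Proj N 1 u) x - deriv u x :=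
    fun x hx => deriv_fun_sub (differentiableAt_of_mem_femSpace hN hP.1 hx)
      (hu.1.differentiable (by simp) x)
  set P := l2Proj N 1 u
  set g := l2Proj N 1 (errDeriv N 1 u)
  set h : ℝ := 1 / N with hh
  have hh0 : 0 < h := by positivity
  have hu' : Continuous (deriv u) := hu.1.continuous_deriv (by norm_num)
  have hup' : Function.Periodic (deriv u) 1 := by
    simpa only [iteratedDeriv_one] using periodic_iteratedDeriv hu.2 1
  have hM := simpsonMean_mem_femSpace hN hg.1
  have hD := centredDiff_mem_femSpace hN hg.1
  rw [← hh] at hM hD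
  have hM2 := isL2_of_continuous hM.1
  have hg2 := isL2_of_continuous hg.1.1
  have key : ∫ x in (0 : ℝ)..1, g x * ((g (x - h) + 4 * g x + g (x + h)) / 6) =
      ∫ x in (0 : ℝ)..1, ((u (x + h) - u (x - h)) / (2 * h) -
        (deriv u (x - h) + 4 * deriv u x + deriv u (x + h)) / 6) * g x := by
    have hae : ∫ x in (0 : ℝ)..1, errDeriv N 1 u x * ((g (x - h) + 4 * g x + g (x + h)) / 6) =
        ∫ x in (0 : ℝ)..1, (deriv P x - deriv u x) * ((g (x - h) + 4 * g x + g (x + h)) / 6) := by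
      refine intervalIntegral.integral_congr_ae ?_
      filter_upwards [ae_notMem_nodes N] with x hx _
      rw [herr_eq x hx]
    -- The centred difference of `g` lies in the space, so pairing it with Pu or with `u` gives the
    -- same value.
    have hDP := hP.2 _ ((femSpace N 1).neg_mem hD)
    have hsimp := integral_deriv_mul_simpson hN hP.1 hg.1
    rw [← hh] at hsimp
    have hneg : ∀ x, (g (x - h) - g (x + h)) / (2 * h) =
        (-fun x => (g (x + h) - g (x - h)) / (2 * h)) x := fun x => by
      simp only [Pi.neg_apply]
      ring
    rw [hg.2 _ hM, hae, integral_sub_mul (isL2_deriv hN hP.1) (isL2_of_continuous hu') hM2, hsimp,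
      integral_centredDiff_mul hP.1.1 hP.1.2.1 hg.1.1 hg.1.2.1,
      integral_sub_mul (isL2_of_continuous (by have := hu.1.continuous; fun_prop))
        (isL2_of_continuous (by fun_prop)) hg2,
      integral_centredDiff_mul hu.1.continuous hu.2 hg.1.1 hg.1.2.1,
      integral_mul_simpsonMean hu' hup' hg.1.1 hg.1.2.1]
    simp only [hneg, hDP]
  have hbound : ∫ x in (0 : ℝ)..1, ((u (x + h) - u (x - h)) / (2 * h) -
      (deriv u (x - h) + 4 * deriv u x + deriv u (x + h)) / 6) * g x ≤
        20 * h ^ 4 * A * l2Norm g := by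
    refine le_trans ?_ (mul_le_mul_of_nonneg_left (integral_abs_le_l2Norm hg2) (by positivity))
    rw [← intervalIntegral.integral_const_mul]
    have huc := hu.1.continuous
    have hgc := hg.1.1
    refine intervalIntegral.integral_mono_on zero_le_one
      (Continuous.intervalIntegrable (by fun_prop) _ _)
      (Continuous.intervalIntegrable (by fun_prop) _ _) fun x _ => ?_
    refine (le_abs_self _).trans ?_
    rw [abs_mul]
    exact mul_le_mul_of_nonneg_right (abs_simpson_le hu.1 hA hh0 x) (abs_nonneg _)
  -- The constant 60 is the coercivity factor 3 times the Simpson constant 20.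
  refine l2Norm_le_of_sq_le (by positivity) ?_
  calc ∫ x in (0 : ℝ)..1, g x * g x ≤ 3 * (20 * h ^ 4 * A * l2Norm g) := by
        refine (integral_sq_le_simpsonMean hg.1.1 hg.1.2.1 h).trans ?_
        rw [key]
        gcongr
    _ = _ := by ring

end Dichotomy

theorem theorem2p5 :
    (∀ k : ℕ, Odd k → ∃ C : ℝ, 0 < C ∧ ∀ N : ℕ, 0 < N → ∀ u ∈ Dichotomy.Cp (k + 2),
      Dichotomy.l2Norm (Dichotomy.l2Proj N k (Dichotomy.errDeriv N k u)) ≤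
        C * (1 / (N : ℝ)) ^ (k + 1) * Dichotomy.supNorm (iteratedDeriv (k + 2) u)) ∧
    (∃ C : ℝ, 0 < C ∧ ∀ N : ℕ, 0 < N → ∀ u ∈ Dichotomy.Cp 5,
      Dichotomy.l2Norm (Dichotomy.l2Proj N 1 (Dichotomy.errDeriv N 1 u)) ≤
        C * (1 / (N : ℝ)) ^ 4 * Dichotomy.supNorm (iteratedDeriv 5 u)) :=
  ⟨fun _ hk => Dichotomy.exists_l2Norm_le_of_odd hk,
    60, by norm_num, fun _ hN _ hu => Dichotomy.l2Norm_le_of_piecewiseLinear hN hu⟩
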